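/- Let $\tau_m(X)=\frac1m\operatorname{tr}(X)$ denote the normalized trace on $\mathcal M_m(\mathbb C)$. For $T=(t_{ij})\in\mathcal M_n(\mathbb C)$, let $\hat T=(t_{ij}I_n)$ act on the direct sum of $n$ copies of $\mathbb C^n$, and define the correlation numerical range $$W_c(T)=\Big\{\langle \hat T e,e\rangle : e=\tfrac1{\sqrt n}(e_1,\dots,e_n),\ e_i\in\mathbb C^n,\ \|e_1\|=\dots=\|e_n\|=1\Big\}.$$ An $n\times n$ correlation matrix is a positive semidefinite matrix in $\mathcal M_n(\mathbb C)$ with all diagonal entries equal to $1$. Let $\mathcal F_n$ be the set of unitarily induced $n\times n$ correlation matrices, i.e. those of the form $A=(\tau_k(U_j^*U_i))_{i,j=1}^n$ for some integer $k\ge 1$ and unitary matrices $U_1,\dots,U_n\in\mathcal M_k(\mathbb C)$. Define $$W_{uc}(T)=\operatorname{co}\{\tau_n(TA):A\in\mathcal F_n\},$$ where $\operatorname{co}$ is the convex hull (without closure). Lemma. Let $n$ be a positive integer. 1. If $n\le 3$, then $W_c(T)=W_{uc}(T)$ for every $T\in\mathcal M_n(\mathbb C)$. 2. If $n>3$, then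 there is $T=T^*\in\mathcal M_n(\mathbb C)$ with $W_{uc}(T)\ne W_c(T)$. -/

import Mathlib

namespace CorrelationRange

noncomputable section

open scoped ComplexOrder

/-- The normalized trace `τ_n` on `n × n` complex matrices. -/
def tau {n : ℕ} (A : Matrix (Fin n) (Fin n) ℂ) : ℂ :=
  (1 / (n : ℂ)) * A.trace

/-- The Hilbert space direct sum of `n` copies of `ℂⁿ`. -/
abbrev DirectSumSpace (n : ℕ) : Type :=
  PiLp 2 (fun _ : Fin n => EuclideanSpace ℂ (Fin n))

/-- The operator `Â = (α_{ij} I_n)` acting on the direct sum of `n` copies of `ℂⁿ`. -/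
def ampliation {n : ℕ} (A : Matrix (Fin n) (Fin n) ℂ) (x : DirectSumSpace n) :
    DirectSumSpace n :=
  WithLp.toLp 2 (fun i => ∑ j, A i j • x j)

/-- The set `E` of all vectors `(1/√n)(e_1, …, e_n)` with `e_1, …, e_n` unit vectors of `ℂⁿ`. -/
def unitTuples (n : ℕ) : Set (DirectSumSpace n) :=
  {x | ∃ e : Fin n → EuclideanSpace ℂ (Fin n), (∀ i, ‖e i‖ = 1) ∧
    x = ((1 / Real.sqrt (n : ℝ) : ℝ) : ℂ) • (WithLp.toLp 2 e : DirectSumSpace n)}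

/-- The correlation numerical range `W_c(A) = {⟨Âe, e⟩ : e ∈ E}`. The inner product of the
mathematical text is linear in its first variable, that of Mathlib in its second. -/
def Wc {n : ℕ} (A : Matrix (Fin n) (Fin n) ℂ) : Set ℂ :=
  {z | ∃ e ∈ unitTuples n, z = inner ℂ e (ampliation A e)}

/-- The set of `n × n` correlation matrices. -/
def correlationMatrices (n : ℕ) : Set (Matrix (Fin n) (Fin n) ℂ) :=
  {B | B.PosSemidef ∧ ∀ i, B i i = 1}

/-- The set of `n × n` unitarily induced correlation matrices: the correlation matrices of
the form `(τ_k(U_j* U_i))_{ij}` with `U_1, …, U_n` unitary `k × k` matrices, `k ≥ 1`. -/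
def unitarilyInduced (n : ℕ) : Set (Matrix (Fin n) (Fin n) ℂ) :=
  {A | A ∈ correlationMatrices n ∧
    ∃ k : ℕ, 0 < k ∧ ∃ U : Fin n → Matrix (Fin k) (Fin k) ℂ,
      (∀ i, U i ∈ Matrix.unitaryGroup (Fin k) ℂ) ∧
      ∀ i j, A i j = tau ((U j).conjTranspose * U i)}

/-- `W_uc(T)`, the convex hull of all `τ_n(TA)` with `A` a unitarily induced correlation
matrix. -/
def Wuc {n : ℕ} (T : Matrix (Fin n) (Fin n) ℂ) : Set ℂ :=
  convexHull ℝ ((fun A => tau (T * A)) '' unitarilyInduced n)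

end

end CorrelationRange

namespace CorrelationRange

open Matrix
open scoped ComplexOrder MatrixOrder

/-! Correlation matrices are exactly the Gram matrices of unit vectors, so `Wc T` is the image of a
convex set under `A ↦ tau (T * A)` and contains `Wuc T`.

For `n ≤ 3` the Gram matrix is a sum of rank-one matrices, and `exists_convex_decomposition` merges
these pairwise until only convex combinations of `vecMulVec p (star p)` with unimodular `p` remain;
those are induced by `1 × 1` unitaries.

For `n > 3`, unit vectors of `ℂ²` satisfy linear relations, the rows of a matrix `Q`, that no
unitaries can satisfy: on an eigenvector of `(U a)ᴴ * U b` such unitaries would give unimodular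
scalars with the same relations. Hence `T = Qᴴ * Q` has `0` in `Wc T` but not in `Wuc T`. -/

/-- The transposed Gram matrix `(⟨e_i, e_j⟩)`, with an inner product linear in its first
variable. -/
noncomputable def gramMatrix {n : ℕ} (e : Fin n → EuclideanSpace ℂ (Fin n)) :
    Matrix (Fin n) (Fin n) ℂ :=
  Matrix.of fun i j => inner ℂ (e j) (e i)

/-- The matrix whose rows are the vectors `e_i`. -/
def rowMatrix {n : ℕ} (e : Fin n → EuclideanSpace ℂ (Fin n)) : Matrix (Fin n) (Fin n) ℂ :=
  Matrix.of fun i k => e i k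

/-! ### Both ranges as images of sets of matrices; the general inclusion -/

lemma gramMatrix_eq {n : ℕ} (e : Fin n → EuclideanSpace ℂ (Fin n)) :
    gramMatrix e = rowMatrix e * (rowMatrix e)ᴴ := by
  ext i j
  simp [gramMatrix, rowMatrix, Matrix.mul_apply, PiLp.inner_apply]

lemma mem_Wc_iff {n : ℕ} (T : Matrix (Fin n) (Fin n) ℂ) (z : ℂ) :
    z ∈ Wc T ↔ ∃ e : Fin n → EuclideanSpace ℂ (Fin n), (∀ i, ‖e i‖ = 1) ∧
      z = tau (T * gramMatrix e) := by
  have key : ∀ e : Fin n → EuclideanSpace ℂ (Fin n),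
      inner ℂ (((1 / Real.sqrt (n : ℝ) : ℝ) : ℂ) • (WithLp.toLp 2 e : DirectSumSpace n))
        (ampliation T (((1 / Real.sqrt (n : ℝ) : ℝ) : ℂ) •
          (WithLp.toLp 2 e : DirectSumSpace n))) = tau (T * gramMatrix e) := by
    intro e
    have hc : ((1 / Real.sqrt (n : ℝ) : ℝ) : ℂ) * ((1 / Real.sqrt (n : ℝ) : ℝ) : ℂ)
        = 1 / (n : ℂ) := by
      rw [← Complex.ofReal_mul, div_mul_div_comm, Real.mul_self_sqrt (Nat.cast_nonneg n)]
      simp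
    generalize ((1 / Real.sqrt (n : ℝ) : ℝ)) = c at hc ⊢
    rw [PiLp.inner_apply]
    simp only [ampliation, tau, Matrix.trace, Matrix.diag_apply, Matrix.mul_apply, gramMatrix,
      Matrix.of_apply, PiLp.smul_apply, inner_sum, inner_smul_left, inner_smul_right,
      Complex.conj_ofReal, ← hc, Finset.mul_sum]
    refine Finset.sum_congr rfl fun i _ => Finset.sum_congr rfl fun j _ => ?_
    ring
  constructor
  · rintro ⟨x, ⟨e, he, rfl⟩, rfl⟩
    exact ⟨e, he, key e⟩
  · rintro ⟨e, he, rfl⟩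
    exact ⟨_, ⟨e, he, rfl⟩, (key e).symm⟩

lemma gramMatrix_mem_correlationMatrices {n : ℕ} {e : Fin n → EuclideanSpace ℂ (Fin n)}
    (he : ∀ i, ‖e i‖ = 1) : gramMatrix e ∈ correlationMatrices n := by
  refine ⟨?_, fun i => ?_⟩
  · rw [gramMatrix_eq]
    exact Matrix.posSemidef_self_mul_conjTranspose _
  · simp [gramMatrix, inner_self_eq_norm_sq_to_K, he]

lemma exists_gramMatrix_eq {n : ℕ} {A : Matrix (Fin n) (Fin n) ℂ}
    (hA : A ∈ correlationMatrices n) :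
    ∃ e : Fin n → EuclideanSpace ℂ (Fin n), (∀ i, ‖e i‖ = 1) ∧ gramMatrix e = A := by
  obtain ⟨B, hB⟩ : ∃ B : Matrix (Fin n) (Fin n) ℂ, A = Bᴴ * B :=
    CStarAlgebra.nonneg_iff_eq_star_mul_self.mp hA.1.nonneg
  have hg : gramMatrix (fun i => WithLp.toLp 2 (Bᴴ i)) = A := by
    rw [gramMatrix_eq, hB]
    have : rowMatrix (fun i => WithLp.toLp 2 (Bᴴ i)) = Bᴴ := rfl
    rw [this, Matrix.conjTranspose_conjTranspose]
  refine ⟨_, fun i => ?_, hg⟩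
  have h1 := hA.2 i
  rw [← hg] at h1
  simp only [gramMatrix, Matrix.of_apply, inner_self_eq_norm_sq_to_K] at h1
  have h2 : (‖(WithLp.toLp 2 (Bᴴ i) : EuclideanSpace ℂ (Fin n))‖) ^ 2 = 1 :=
    Complex.ofReal_injective ((Complex.ofReal_pow _ 2).trans h1)
  exact (pow_eq_one_iff_of_nonneg (norm_nonneg _) two_ne_zero).mp h2

lemma Wc_eq_image {n : ℕ} (T : Matrix (Fin n) (Fin n) ℂ) :
    Wc T = (fun A => tau (T * A)) '' correlationMatrices n := by
  ext z
  rw [mem_Wc_iff]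
  constructor
  · rintro ⟨e, he, rfl⟩
    exact ⟨_, gramMatrix_mem_correlationMatrices he, rfl⟩
  · rintro ⟨A, hA, rfl⟩
    obtain ⟨e, he, rfl⟩ := exists_gramMatrix_eq hA
    exact ⟨e, he, rfl⟩

lemma convex_correlationMatrices (n : ℕ) : Convex ℝ (correlationMatrices n) := by
  intro A hA B hB a b ha hb hab
  refine ⟨(hA.1.smul ha).add (hB.1.smul hb), fun i => ?_⟩
  simp only [Matrix.add_apply, Matrix.smul_apply, hA.2 i, hB.2 i, Complex.real_smul, mul_one]
  exact_mod_cast hab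

lemma isLinearMap_tau_mul {n : ℕ} (T : Matrix (Fin n) (Fin n) ℂ) :
    IsLinearMap ℝ (fun A : Matrix (Fin n) (Fin n) ℂ => tau (T * A)) where
  map_add A B := by simp [tau, mul_add]
  map_smul c A := by
    simp only [tau, Matrix.mul_smul, Matrix.trace_smul, Complex.real_smul]
    ring

lemma Wuc_subset_Wc {n : ℕ} (T : Matrix (Fin n) (Fin n) ℂ) : Wuc T ⊆ Wc T := by
  rw [Wc_eq_image]
  refine convexHull_min (Set.image_mono fun A hA => hA.1) ?_
  exact (convex_correlationMatrices n).is_linear_image (isLinearMap_tau_mul T)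

/-! ### Size at most three -/

lemma vecMulVec_mem_unitarilyInduced {n : ℕ} {p : Fin n → ℂ} (hp : ∀ i, p i * star (p i) = 1) :
    vecMulVec p (star p) ∈ unitarilyInduced n := by
  refine ⟨⟨Matrix.posSemidef_vecMulVec_self_star p, fun i => by
    simpa [vecMulVec_apply] using hp i⟩, 1, one_pos, fun i => Matrix.of fun _ _ => p i,
    fun i => ?_, fun i j => ?_⟩
  · rw [Matrix.mem_unitaryGroup_iff]
    ext a b
    have := hp i
    simp only [RCLike.star_def] at this
    simp [Matrix.mul_apply, Subsingleton.elim a b, Matrix.star_apply, this, Matrix.one_apply]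
  · simp [tau, Matrix.trace, Matrix.mul_apply, vecMulVec_apply, mul_comm]

/-- Four real parameters suffice to make three Hermitian quadratic values vanish. -/
lemma exists_isHermitian_diag_eq_zero {n : ℕ} (hn : n ≤ 3) (E : Matrix (Fin n) (Fin 2) ℂ) :
    ∃ H : Matrix (Fin 2) (Fin 2) ℂ, H.IsHermitian ∧ H ≠ 0 ∧ ∀ i, (E * H * Eᴴ) i i = 0 := by
  let f : (ℝ × ℝ × ℂ) →ₗ[ℝ] (Fin n → ℝ) :=
    { toFun := fun v i => v.1 * Complex.normSq (E i 0) + v.2.1 * Complex.normSq (E i 1)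
        + 2 * (v.2.2 * (E i 0 * star (E i 1))).re
      map_add' := fun u v => by
        ext i; simp; ring
      map_smul' := fun c v => by
        ext i; simp; ring }
  -- `f` sends the entries `a`, `b`, `z` of a Hermitian matrix to the diagonal of `E * H * Eᴴ`; its
  -- domain has real dimension 4, more than `n`.
  have hk : LinearMap.ker f ≠ ⊥ := LinearMap.ker_ne_bot_of_finrank_lt (by
    simp [Module.finrank_prod, Complex.finrank_real_complex]; omega)
  obtain ⟨⟨a, b, z⟩, hv, hne⟩ := (Submodule.ne_bot_iff _).mp hk
  refine ⟨!![(a : ℂ), z; star z, (b : ℂ)], ?_, ?_, fun i => ?_⟩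
  · ext i j
    fin_cases i <;> fin_cases j <;> simp
  · intro h
    apply hne
    have h0 := congrFun (congrFun h 0) 0
    have h1 := congrFun (congrFun h 0) 1
    have h2 := congrFun (congrFun h 1) 1
    simp at h0 h1 h2
    simp [h0, h1, h2]
  · have hi := congrFun (LinearMap.mem_ker.mp hv) i
    simp [f] at hi
    simp [Matrix.mul_apply, Fin.sum_univ_two]
    apply Complex.ext
    · simp [Complex.normSq_apply] at hi ⊢
      linarith
    · simp
      ring

/-- Rotating by an eigenbasis of the `H` above leaves `E * Eᴴ` unchanged and turns the vanishing
diagonal into a relation between squared moduli, with the eigenvalues as coefficients. -/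
lemma exists_rotation {n : ℕ} (hn : n ≤ 3) (E : Matrix (Fin n) (Fin 2) ℂ) :
    ∃ (F : Matrix (Fin n) (Fin 2) ℂ) (l : Fin 2 → ℝ), F * Fᴴ = E * Eᴴ ∧ l ≠ 0 ∧
      ∀ i, l 0 * Complex.normSq (F i 0) + l 1 * Complex.normSq (F i 1) = 0 := by
  obtain ⟨H, hH, hne, hd⟩ := exists_isHermitian_diag_eq_zero hn E
  have hs := hH.spectral_theorem
  rw [Unitary.conjStarAlgAut_apply] at hs
  set U : Matrix (Fin 2) (Fin 2) ℂ := (hH.eigenvectorUnitary : Matrix (Fin 2) (Fin 2) ℂ)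
  have hUU : U * Uᴴ = 1 := Unitary.coe_mul_star_self hH.eigenvectorUnitary
  refine ⟨E * U, hH.eigenvalues, ?_, ?_, fun i => ?_⟩
  · rw [Matrix.conjTranspose_mul, Matrix.mul_assoc, ← Matrix.mul_assoc U, hUU, Matrix.one_mul]
  · intro h
    exact hne (hH.eigenvalues_eq_zero_iff.mp h)
  · have h1 : E * H * Eᴴ =
        (E * U) * diagonal (fun k => (hH.eigenvalues k : ℂ)) * (E * U)ᴴ := by
      conv_lhs => rw [hs]
      rw [Matrix.conjTranspose_mul]
      simp only [Matrix.mul_assoc, Matrix.star_eq_conjTranspose]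
      rfl
    have h2 := hd i
    rw [h1] at h2
    generalize E * U = F at h2 ⊢
    rw [Matrix.mul_apply] at h2
    simp only [Matrix.mul_diagonal, Fin.sum_univ_two, Matrix.conjTranspose_apply] at h2
    have h3 := congrArg Complex.re h2
    simp [Complex.normSq_apply] at h3 ⊢
    linarith

/-- A sum of two outer products of vectors with at most three entries is a convex combination of
two outer products with the same diagonal. -/
lemma exists_convex_decomposition {n : ℕ} (hn : n ≤ 3) (p q : Fin n → ℂ) :
    ∃ (z w : Fin n → ℂ) (s t : ℝ), 0 ≤ s ∧ 0 ≤ t ∧ s + t = 1 ∧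
      vecMulVec p (star p) + vecMulVec q (star q) =
        s • vecMulVec z (star z) + t • vecMulVec w (star w) ∧
      (∀ i, Complex.normSq (z i) = Complex.normSq (p i) + Complex.normSq (q i)) ∧
      (∀ i, Complex.normSq (w i) = Complex.normSq (p i) + Complex.normSq (q i)) := by
  obtain ⟨F, l, hF, hl, hd⟩ := exists_rotation hn (Matrix.of fun i k => ![p i, q i] k)
  have hF' : ∀ i j, F i 0 * star (F j 0) + F i 1 * star (F j 1) =
      p i * star (p j) + q i * star (q j) := by
    intro i j
    have := congrFun (congrFun hF i) j
    simpa [Matrix.mul_apply, Fin.sum_univ_two] using this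
  have hN : ∀ i, Complex.normSq (F i 0) + Complex.normSq (F i 1) =
      Complex.normSq (p i) + Complex.normSq (q i) := by
    intro i
    have := congrArg Complex.re (hF' i i)
    simp [Complex.normSq_apply] at this ⊢
    linarith
  by_cases h0 : ∀ i, Complex.normSq (p i) + Complex.normSq (q i) = 0
  · have hp : p = 0 := by
      ext i
      exact Complex.normSq_eq_zero.mp (by
        linarith [h0 i, Complex.normSq_nonneg (p i), Complex.normSq_nonneg (q i)])
    have hq : q = 0 := by
      ext i
      exact Complex.normSq_eq_zero.mp (by
        linarith [h0 i, Complex.normSq_nonneg (p i), Complex.normSq_nonneg (q i)])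
    refine ⟨0, 0, 1, 0, by norm_num, by norm_num, by norm_num, ?_, ?_, ?_⟩ <;> simp [hp, hq]
  push Not at h0
  obtain ⟨i₀, hi₀⟩ := h0
  have hpos : 0 < Complex.normSq (p i₀) + Complex.normSq (q i₀) :=
    lt_of_le_of_ne (add_nonneg (Complex.normSq_nonneg _) (Complex.normSq_nonneg _)) hi₀.symm
  -- Equal eigenvalues would both vanish, since row `i₀` is nonzero.
  have hne : l 0 - l 1 ≠ 0 := by
    intro h
    have h1 : l 1 = l 0 := by linarith
    have h2 := hd i₀
    rw [h1, ← mul_add, hN] at h2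
    have h3 := (mul_eq_zero.mp h2).resolve_right hi₀
    apply hl
    ext k
    fin_cases k <;> simp [h1, h3]
  -- With the row norm, the eigenvalue relation fixes the share `s` of the first column, the same in
  -- every row.
  obtain ⟨s, hs⟩ : ∃ s, s = -l 1 / (l 0 - l 1) := ⟨_, rfl⟩
  have hα : ∀ i, Complex.normSq (F i 0) = s * (Complex.normSq (p i) + Complex.normSq (q i)) := by
    intro i
    rw [hs, ← hN, div_mul_eq_mul_div, eq_div_iff hne]
    linarith [hd i]
  have hβ : ∀ i, Complex.normSq (F i 1) =
      (1 - s) * (Complex.normSq (p i) + Complex.normSq (q i)) := by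
    intro i
    linarith [hα i, hN i]
  have hs0 : 0 ≤ s := by
    by_contra h
    nlinarith [hα i₀, Complex.normSq_nonneg (F i₀ 0)]
  have hs1 : 0 ≤ 1 - s := by
    by_contra h
    nlinarith [hβ i₀, Complex.normSq_nonneg (F i₀ 1)]
  -- When `r = 0` the column `g` is zero and cannot be rescaled; `h` supplies a vector with the
  -- required moduli, whose weight is zero. Below, `h` is the other column.
  have scale : ∀ (r : ℝ) (g h : Fin n → ℂ), 0 ≤ r →
      (∀ i, Complex.normSq (g i) = r * (Complex.normSq (p i) + Complex.normSq (q i))) →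
      (r = 0 → ∀ i, Complex.normSq (h i) = Complex.normSq (p i) + Complex.normSq (q i)) →
      ∃ z : Fin n → ℂ, r • vecMulVec z (star z) = vecMulVec g (star g) ∧
        ∀ i, Complex.normSq (z i) = Complex.normSq (p i) + Complex.normSq (q i) := by
    intro r g h hr hg hh
    rcases hr.eq_or_lt with h0 | h0
    · refine ⟨h, ?_, hh h0.symm⟩
      have : g = 0 := by
        ext i
        exact Complex.normSq_eq_zero.mp (by rw [hg, ← h0, zero_mul])
      simp [this, ← h0]
    · have hsq : Real.sqrt r * Real.sqrt r = r := Real.mul_self_sqrt hr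
      have hsq0 : Real.sqrt r ≠ 0 := (Real.sqrt_pos.mpr h0).ne'
      refine ⟨fun i => ((Real.sqrt r)⁻¹ : ℝ) * g i, ?_, fun i => ?_⟩
      · ext i j
        have h1 : (r : ℂ) * (((Real.sqrt r)⁻¹ : ℝ) * ((Real.sqrt r)⁻¹ : ℝ)) = 1 := by
          rw [← Complex.ofReal_mul, ← Complex.ofReal_mul, ← mul_inv, hsq, mul_inv_cancel₀ h0.ne',
            Complex.ofReal_one]
        simp only [Matrix.smul_apply, vecMulVec_apply, Pi.star_apply, star_mul', RCLike.star_def,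
          Complex.conj_ofReal, Complex.real_smul]
        linear_combination (g i * (starRingEnd ℂ) (g j)) * h1
      · rw [Complex.normSq_mul, Complex.normSq_ofReal, hg, ← mul_inv, hsq, ← mul_assoc,
          inv_mul_cancel₀ h0.ne', one_mul]
  obtain ⟨z, hz, hz'⟩ := scale s (fun i => F i 0) (fun i => F i 1) hs0 hα (fun h i => by
    rw [hβ, h]; ring)
  obtain ⟨w, hw, hw'⟩ := scale (1 - s) (fun i => F i 1) (fun i => F i 0) hs1 hβ (fun h i => by
    rw [hα, show s = 1 by linarith]; ring)
  refine ⟨z, w, s, 1 - s, hs0, hs1, by ring, ?_, hz', hw'⟩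
  rw [hz, hw]
  ext i j
  simpa [vecMulVec_apply] using (hF' i j).symm

/-- The vector `p` is an accumulator: merging `x 0` into it gives two sums with one term fewer, and
convexity of `S` recombines them. -/
lemma sum_vecMulVec_mem {n : ℕ} (hn : n ≤ 3) {S : Set (Matrix (Fin n) (Fin n) ℂ)}
    (hS : Convex ℝ S) (h1 : unitarilyInduced n ⊆ S) (m : ℕ) :
    ∀ (p : Fin n → ℂ) (x : Fin m → Fin n → ℂ),
      (∀ i, Complex.normSq (p i) + ∑ k, Complex.normSq (x k i) = 1) →
      vecMulVec p (star p) + ∑ k, vecMulVec (x k) (star (x k)) ∈ S := by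
  induction m with
  | zero =>
    intro p x hx
    simp only [Finset.univ_eq_empty, Finset.sum_empty, add_zero] at hx ⊢
    refine h1 (vecMulVec_mem_unitarilyInduced fun i => ?_)
    rw [RCLike.star_def, Complex.mul_conj, hx i, Complex.ofReal_one]
  | succ m ih =>
    intro p x hx
    obtain ⟨z, w, s, t, hs, ht, hst, hd, hz, hw⟩ := exists_convex_decomposition hn p (x 0)
    have hz' := ih z (fun k => x k.succ) fun i => by
      have := hx i
      rw [Fin.sum_univ_succ] at this
      rw [hz, ← this, add_assoc]
    have hw' := ih w (fun k => x k.succ) fun i => by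
      have := hx i
      rw [Fin.sum_univ_succ] at this
      rw [hw, ← this, add_assoc]
    have := hS hz' hw' hs ht hst
    convert this using 1
    rw [Fin.sum_univ_succ, ← add_assoc, hd, smul_add, smul_add, add_add_add_comm, ← add_smul,
      hst, one_smul]

lemma Wc_subset_Wuc {n : ℕ} (hn : n ≤ 3) (T : Matrix (Fin n) (Fin n) ℂ) : Wc T ⊆ Wuc T := by
  intro z hz
  obtain ⟨e, he, rfl⟩ := (mem_Wc_iff T z).mp hz
  have hS : Convex ℝ {A | tau (T * A) ∈ Wuc T} :=
    (convex_convexHull ℝ _).is_linear_preimage (isLinearMap_tau_mul T)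
  have h := sum_vecMulVec_mem hn hS
    (fun A hA => subset_convexHull ℝ _ ⟨A, hA, rfl⟩) n 0 (fun k i => e i k) fun i => by
      have := he i
      rw [EuclideanSpace.norm_eq, Real.sqrt_eq_one] at this
      simpa [Complex.normSq_eq_norm_sq] using this
  have hg : vecMulVec (0 : Fin n → ℂ) (star 0) +
      ∑ k, vecMulVec (fun i => e i k) (star fun i => e i k) = gramMatrix e := by
    ext i j
    simp [gramMatrix_eq, rowMatrix, Matrix.mul_apply, Matrix.sum_apply, vecMulVec_apply]
  rw [hg] at h
  exact h

/-! ### Size at least four -/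

/-- First coordinates of unit vectors in `ℂ²`, four of which have affinely independent Bloch
vectors. -/
noncomputable def firstCoord (i : ℕ) : ℂ :=
  if i = 1 then 0 else if i = 2 ∨ i = 3 then ((Real.sqrt 2)⁻¹ : ℝ) else 1

/-- The second coordinates belonging to `firstCoord`. -/
noncomputable def secondCoord (i : ℕ) : ℂ :=
  if i = 1 then 1 else if i = 2 then ((Real.sqrt 2)⁻¹ : ℝ)
    else if i = 3 then ((Real.sqrt 2)⁻¹ : ℝ) * Complex.I else 0

lemma normSq_firstCoord_add (i : ℕ) :
    Complex.normSq (firstCoord i) + Complex.normSq (secondCoord i) = 1 := by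
  have h : (Real.sqrt 2)⁻¹ * (Real.sqrt 2)⁻¹ = (2 : ℝ)⁻¹ := by
    rw [← mul_inv, Real.mul_self_sqrt (by norm_num)]
  unfold firstCoord secondCoord
  split_ifs <;> simp_all [Complex.normSq_ofReal] <;> norm_num

/-- No combination of the two coordinate vectors is unimodular. -/
lemma not_forall_normSq_eq_one (y : ℂ)
    (h : ∀ i < 4, Complex.normSq (firstCoord i + secondCoord i * y) = 1) : False := by
  have hr : (Real.sqrt 2)⁻¹ * (Real.sqrt 2)⁻¹ = (2 : ℝ)⁻¹ := by
    rw [← mul_inv, Real.mul_self_sqrt (by norm_num)]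
  have h1 := h 1 (by norm_num)
  have h2 := h 2 (by norm_num)
  have h3 := h 3 (by norm_num)
  have e1 : firstCoord 1 = 0 ∧ secondCoord 1 = 1 := by simp [firstCoord, secondCoord]
  have e2 : firstCoord 2 = ((Real.sqrt 2)⁻¹ : ℝ) ∧ secondCoord 2 = ((Real.sqrt 2)⁻¹ : ℝ) := by
    simp [firstCoord, secondCoord]
  have e3 : firstCoord 3 = ((Real.sqrt 2)⁻¹ : ℝ) ∧
      secondCoord 3 = ((Real.sqrt 2)⁻¹ : ℝ) * Complex.I := by
    simp [firstCoord, secondCoord]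
  rw [e1.1, e1.2, zero_add, one_mul, Complex.normSq_apply] at h1
  rw [e2.1, e2.2, ← mul_one_add, Complex.normSq_mul, Complex.normSq_ofReal, hr,
    Complex.normSq_apply] at h2
  rw [e3.1, e3.2, mul_assoc, ← mul_one_add, Complex.normSq_mul, Complex.normSq_ofReal, hr,
    Complex.normSq_apply] at h3
  simp at h2 h3
  -- Since `|y| = 1`, the equations `|1 + y|² = 2` and `|1 + iy|² = 2` kill the real and imaginary
  -- parts.
  have ha : y.re = 0 := by linarith
  have hb : y.im = 0 := by linarith
  simp [ha, hb] at h1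

/-- The map `x ↦ (x_i - α_i x_0 - β_i x_1)` with the coordinates above as coefficients. -/
noncomputable def relationMatrix (n : ℕ) (a b : Fin n) : Matrix (Fin n) (Fin n) ℂ :=
  Matrix.of fun i j => (if j = i then 1 else 0) - (if j = a then firstCoord i else 0)
    - (if j = b then secondCoord i else 0)

lemma sum_relationMatrix_smul {n : ℕ} (a b : Fin n) {M : Type*} [AddCommGroup M] [Module ℂ M]
    (x : Fin n → M) (i : Fin n) :
    ∑ j, relationMatrix n a b i j • x j = x i - firstCoord i • x a - secondCoord i • x b := by
  simp [relationMatrix, sub_smul, ite_smul, Finset.sum_sub_distrib]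

/-- The values of `QᴴQ` on unitarily induced matrices are normalized Frobenius norms. -/
lemma trace_conjTranspose_mul_self_mul {n k : ℕ} (Q A : Matrix (Fin n) (Fin n) ℂ)
    (U : Fin n → Matrix (Fin k) (Fin k) ℂ) (hA : ∀ i j, A i j = tau ((U j)ᴴ * U i)) :
    (Qᴴ * Q * A).trace = ∑ i, tau ((∑ j, Q i j • U j)ᴴ * ∑ j, Q i j • U j) := by
  have h : ∀ i, tau ((∑ j, Q i j • U j)ᴴ * ∑ j, Q i j • U j) =
      ∑ j, ∑ l, star (Q i j) * Q i l * A l j := by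
    intro i
    simp only [hA, tau, Matrix.conjTranspose_sum, Matrix.sum_mul,
      Matrix.trace_sum, Matrix.conjTranspose_smul, Matrix.smul_mul, Matrix.mul_smul,
      Matrix.trace_smul, smul_eq_mul, Finset.mul_sum]
    rw [Finset.sum_comm]
    refine Finset.sum_congr rfl fun j _ => Finset.sum_congr rfl fun l _ => ?_
    ring
  simp only [h, Matrix.trace, Matrix.diag_apply, Matrix.mul_apply, Matrix.conjTranspose_apply,
    Finset.sum_mul]
  calc _ = ∑ j, ∑ i, ∑ l, star (Q i j) * Q i l * A l j :=
        Finset.sum_congr rfl fun j _ => Finset.sum_comm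
    _ = _ := Finset.sum_comm

lemma tau_conjTranspose_mul_self_nonneg {k : ℕ} (B : Matrix (Fin k) (Fin k) ℂ) :
    0 ≤ tau (Bᴴ * B) := by
  have h := (Matrix.posSemidef_conjTranspose_mul_self B).trace_nonneg
  have : (0 : ℂ) ≤ 1 / (k : ℂ) := by
    rw [one_div, ← Complex.ofReal_natCast, ← Complex.ofReal_inv]
    exact Complex.zero_le_real.mpr (by positivity)
  exact mul_nonneg this h

lemma eq_zero_of_tau_conjTranspose_mul_self {k : ℕ} (hk : 0 < k) {B : Matrix (Fin k) (Fin k) ℂ}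
    (h : tau (Bᴴ * B) = 0) : B = 0 := by
  have hk' : (1 / (k : ℂ)) ≠ 0 := by simpa using hk.ne'
  exact Matrix.trace_conjTranspose_mul_self_eq_zero_iff.mp ((mul_eq_zero.mp h).resolve_left hk')

/-- Norm preservation for unitary matrices. -/
lemma star_dotProduct_mulVec {k : ℕ} {U : Matrix (Fin k) (Fin k) ℂ}
    (hU : U ∈ Matrix.unitaryGroup (Fin k) ℂ) (v : Fin k → ℂ) :
    star (U *ᵥ v) ⬝ᵥ (U *ᵥ v) = star v ⬝ᵥ v := by
  rw [Matrix.star_mulVec, ← Matrix.dotProduct_mulVec, Matrix.mulVec_mulVec]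
  have : Uᴴ * U = 1 := Matrix.mem_unitaryGroup_iff'.mp hU
  rw [this, Matrix.one_mulVec]

/-- Unitary matrices in the span of two of them share their coefficients with a unimodular
scalar family. -/
lemma exists_forall_normSq_eq_one {n k : ℕ} (hk : 0 < k) {a b : Fin n} {α β : Fin n → ℂ}
    {U : Fin n → Matrix (Fin k) (Fin k) ℂ} (hU : ∀ i, U i ∈ Matrix.unitaryGroup (Fin k) ℂ)
    (h : ∀ i, U i = α i • U a + β i • U b) :
    ∃ y : ℂ, ∀ i, Complex.normSq (α i + β i * y) = 1 := by
  have : Nonempty (Fin k) := ⟨⟨0, hk⟩⟩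
  -- On an eigenvector `v`, `U b` acts as `y • U a`, so `U i` sends `v` to `(α i + β i * y) • (U a
  -- *ᵥ v)`; comparing norms gives the claim.
  obtain ⟨y, hy⟩ := Module.End.exists_eigenvalue (Matrix.toLin' ((U a)ᴴ * U b))
  obtain ⟨v, hv⟩ := hy.exists_hasEigenvector
  have hv1 : ((U a)ᴴ * U b) *ᵥ v = y • v := by simpa using hv.apply_eq_smul
  have hv2 : U b *ᵥ v = y • (U a *ᵥ v) := by
    have : U a * (U a)ᴴ = 1 := Matrix.mem_unitaryGroup_iff.mp (hU a)
    rw [← Matrix.mulVec_smul, ← hv1, Matrix.mulVec_mulVec, ← Matrix.mul_assoc, this,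
      Matrix.one_mul]
  refine ⟨y, fun i => ?_⟩
  have h1 : U i *ᵥ v = (α i + β i * y) • (U a *ᵥ v) := by
    conv_lhs => rw [h i]
    rw [Matrix.add_mulVec, Matrix.smul_mulVec, Matrix.smul_mulVec, hv2, smul_smul,
      ← add_smul]
  have h2 := star_dotProduct_mulVec (hU i) v
  rw [h1, star_smul, smul_dotProduct, dotProduct_smul, star_dotProduct_mulVec (hU a), smul_smul,
    smul_eq_mul] at h2
  have h3 : star v ⬝ᵥ v ≠ 0 := fun h => hv.2 (dotProduct_star_self_eq_zero.mp h)
  have h4 := mul_right_cancel₀ h3 (h2.trans (one_mul _).symm)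
  rw [RCLike.star_def, ← Complex.normSq_eq_conj_mul_self] at h4
  exact_mod_cast h4

/-- Each generator has positive real part, as a zero value would force every relation on the
unitaries. An open half-plane is convex, so the hull, taken without closure, also avoids `0`. -/
lemma zero_notMem_Wuc {n : ℕ} (hn : 3 < n) :
    (0 : ℂ) ∉ Wuc ((relationMatrix n ⟨0, by omega⟩ ⟨1, by omega⟩)ᴴ *
      relationMatrix n ⟨0, by omega⟩ ⟨1, by omega⟩) := by
  intro h0
  have hsub : Wuc ((relationMatrix n ⟨0, by omega⟩ ⟨1, by omega⟩)ᴴ *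
      relationMatrix n ⟨0, by omega⟩ ⟨1, by omega⟩) ⊆ {z : ℂ | 0 < z.re} := by
    refine convexHull_min ?_ (convex_halfSpace_re_gt 0)
    rintro _ ⟨A, ⟨-, k, hk, U, hU, hA⟩, rfl⟩
    have hnn : ∀ i ∈ Finset.univ,
        0 ≤ tau ((∑ j, relationMatrix n ⟨0, by omega⟩ ⟨1, by omega⟩ i j • U j)ᴴ *
          ∑ j, relationMatrix n ⟨0, by omega⟩ ⟨1, by omega⟩ i j • U j) :=
      fun i _ => tau_conjTranspose_mul_self_nonneg _
    have hS := Finset.sum_nonneg hnn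
    have hn' : (0 : ℝ) < 1 / (n : ℝ) := by
      have : (0 : ℝ) < n := by exact_mod_cast (by omega : 0 < n)
      positivity
    have hcast : (1 / (n : ℂ)) = ((1 / (n : ℝ) : ℝ) : ℂ) := by simp
    have hre := (Complex.le_def.mp hS).1
    change 0 < (tau _).re
    rw [tau, trace_conjTranspose_mul_self_mul _ _ U hA, hcast, Complex.re_ofReal_mul]
    refine mul_pos hn' (lt_of_le_of_ne hre fun heq => ?_)
    have hz := Complex.ext (z := 0) heq (Complex.le_def.mp hS).2
    have hall := (Finset.sum_eq_zero_iff_of_nonneg hnn).mp hz.symm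
    obtain ⟨y, hy⟩ := exists_forall_normSq_eq_one (a := ⟨0, by omega⟩) (b := ⟨1, by omega⟩)
      (α := fun i => firstCoord i) (β := fun i => secondCoord i) hk hU fun i => by
        have := eq_zero_of_tau_conjTranspose_mul_self hk (hall i (Finset.mem_univ i))
        rw [sum_relationMatrix_smul, sub_sub, sub_eq_zero] at this
        exact this
    exact not_forall_normSq_eq_one y fun i hi => hy ⟨i, by omega⟩
  exact lt_irrefl (0 : ℝ) (hsub h0)

/-- The vectors with the chosen coordinates in a fixed orthonormal pair satisfy the relations,
because those with indices 0 and 1 are the pair itself. -/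
lemma zero_mem_Wc {n : ℕ} (hn : 3 < n) :
    (0 : ℂ) ∈ Wc ((relationMatrix n ⟨0, by omega⟩ ⟨1, by omega⟩)ᴴ *
      relationMatrix n ⟨0, by omega⟩ ⟨1, by omega⟩) := by
  rw [mem_Wc_iff]
  have hab : (⟨0, by omega⟩ : Fin n) ≠ ⟨1, by omega⟩ := by simp
  refine ⟨fun i => firstCoord i • EuclideanSpace.single ⟨0, by omega⟩ 1 +
    secondCoord i • EuclideanSpace.single ⟨1, by omega⟩ 1, fun i => ?_, ?_⟩
  · rw [← sq_eq_sq₀ (norm_nonneg _) zero_le_one, one_pow, sq,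
      norm_add_sq_eq_norm_sq_add_norm_sq_of_inner_eq_zero (𝕜 := ℂ)]
    · have := normSq_firstCoord_add i
      simpa [norm_smul, Complex.normSq_eq_norm_sq, sq] using this
    · simp [inner_smul_left, inner_smul_right, EuclideanSpace.inner_single_left]
  · have hz : relationMatrix n ⟨0, by omega⟩ ⟨1, by omega⟩ *
        rowMatrix (fun i => firstCoord i • EuclideanSpace.single ⟨0, by omega⟩ 1 +
          secondCoord i • EuclideanSpace.single ⟨1, by omega⟩ 1) = 0 := by
      ext i k
      have := sum_relationMatrix_smul (⟨0, by omega⟩ : Fin n) ⟨1, by omega⟩ (fun j : Fin n =>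
        (firstCoord j • EuclideanSpace.single ⟨0, by omega⟩ 1 +
          secondCoord j • EuclideanSpace.single ⟨1, by omega⟩ 1 : EuclideanSpace ℂ (Fin n)) k) i
      simp only [smul_eq_mul] at this
      rw [Matrix.mul_apply, Matrix.zero_apply]
      refine this.trans ?_
      have h0 : firstCoord 0 = 1 ∧ secondCoord 0 = 0 := by simp [firstCoord, secondCoord]
      have h1 : firstCoord 1 = 0 ∧ secondCoord 1 = 1 := by simp [firstCoord, secondCoord]
      simp only [h0.1, h0.2, h1.1, h1.2, PiLp.add_apply, PiLp.smul_apply, smul_eq_mul]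
      ring
    rw [gramMatrix_eq, Matrix.mul_assoc, ← Matrix.mul_assoc _ _ (rowMatrix _)ᴴ, hz]
    simp [tau]

end CorrelationRange

theorem mainTheorem6 (n : ℕ) (hn : 0 < n) :
    (n ≤ 3 → ∀ T : Matrix (Fin n) (Fin n) ℂ,
      CorrelationRange.Wc T = CorrelationRange.Wuc T) ∧
    (3 < n → ∃ T : Matrix (Fin n) (Fin n) ℂ, T.IsHermitian ∧
      CorrelationRange.Wuc T ≠ CorrelationRange.Wc T) := by
  refine ⟨fun h T => (CorrelationRange.Wc_subset_Wuc h T).antisymm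
    (CorrelationRange.Wuc_subset_Wc T), fun h => ⟨_, Matrix.isHermitian_conjTranspose_mul_self
      (CorrelationRange.relationMatrix n ⟨0, by omega⟩ ⟨1, by omega⟩), fun heq => ?_⟩⟩
  exact CorrelationRange.zero_notMem_Wuc h (heq ▸ CorrelationRange.zero_mem_Wc h)
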